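/- For $1\le i\le N$ let $(\mathcal E_i,\mathcal D(\mathcal E_i))$ be a symmetric Dirichlet form on $L^2(\mu_i)$ (a densely defined, closed, symmetric, non-negative bilinear form that is Markovian, i.e. $f\in\mathcal D(\mathcal E_i)$ implies $(f\vee 0)\wedge 1\in\mathcal D(\mathcal E_i)$ with no larger energy) over a $\sigma$-finite measure space $(E_i,\mathcal F_i,\mu_i)$. Let $\mu=\prod_{i=1}^N\mu_i$, let $\mathcal D(\mathcal E)$ be the class of all $f\in L^2(\mu)$ such that for every $1\le i\le N$ one has $f(x,\cdot)\in\mathcal D(\mathcal E_i)$ for $\big(\prod_{j\ne i}\mu_j\big)$-a.e. $x\in\prod_{j\ne i}E_j$, and $$\sum_{i=1}^N\int_{\prod_{j\ne i}E_j}\mathcal E_i(f(x,\cdot),f(x,\cdot))\Big(\prod_{j\ne i}\mu_j\Big)(dx)<\infty,$$ and put $$\mathcal E(f,g)=\sum_{i=1}^N\int_{\prod_{j\ne i}E_j}\mathcal E_i(f(x,\cdot),g(x,\cdot))\Big(\prod_{j\ne i}\mu_j\Big)(dx),\qquad f,g\in\mathcal D(\mathcal E).$$ Let $p_1,\dots,p_N\in(0,\infty)$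 be such that for every $1\le i\le N$ the super Poincaré inequality $$\mu_i(f^2)\le r\,\mathcal E_i(f,f)+c_i\big(1+r^{-p_i}\big)\mu_i(|f|)^2,\qquad r>0,\ f\in\mathcal D(\mathcal E_i),$$ holds for some constant $c_i>0$. Then there exists a constant $c>0$ such that $$\mu(f^2)\le r\,\mathcal E(f,f)+c\big(1+r^{-\sum_{i=1}^N p_i}\big)\mu(|f|)^2,\qquad r>0,\ f\in\mathcal D(\mathcal E).$$ Here $\mu(f)=\int f\,d\mu$, and the inequalities hold trivially when $\mu_i(|f|)=\infty$, respectively $\mu(|f|)=\infty$. -/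

import Mathlib

open MeasureTheory Filter Topology

noncomputable section

/-- A symmetric Dirichlet form on `L²(μ)`: a densely defined, symmetric, nonnegative definite,
closed bilinear form on which the unit contraction `f ↦ (f ∨ 0) ∧ 1` operates. -/
structure SymmDirichletForm {Ω : Type*} [MeasurableSpace Ω] (μ : Measure Ω) where
  /-- the domain `𝒟(ℰ)` -/
  domain : Submodule ℝ (Lp ℝ 2 μ)
  dense_domain : Dense (domain : Set (Lp ℝ 2 μ))
  /-- the bilinear form `ℰ : 𝒟(ℰ) × 𝒟(ℰ) → ℝ` -/
  form : domain →ₗ[ℝ] domain →ₗ[ℝ] ℝ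
  symm : ∀ f g : domain, form f g = form g f
  nonneg : ∀ f : domain, 0 ≤ form f f
  /-- `𝒟(ℰ)` is complete for the norm `(‖f‖² + ℰ(f,f))^{1/2}`. -/
  closed : ∀ u : ℕ → domain,
    (∀ ε > 0, ∃ n₀ : ℕ, ∀ m ≥ n₀, ∀ n ≥ n₀,
      ‖(u m - u n : Lp ℝ 2 μ)‖ ^ 2 + form (u m - u n) (u m - u n) < ε) →
    ∃ v : domain,
      Tendsto (fun n => ‖(u n - v : Lp ℝ 2 μ)‖ ^ 2 + form (u n - v) (u n - v)) atTop (𝓝 0)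
  markov : ∀ f : domain, ∃ g : domain,
    ((g : Lp ℝ 2 μ) =ᵐ[μ] fun x => min (max ((f : Lp ℝ 2 μ) x) 0) 1) ∧ form g g ≤ form f f

namespace SymmDirichletForm

variable {Ω : Type*} [MeasurableSpace Ω] {μ : Measure Ω}

/-- The function `g` lies in `𝒟(ℰ)`, that is, it is square integrable and its class does. -/
def MemDomain (ℰ : SymmDirichletForm μ) (g : Ω → ℝ) : Prop :=
  ∃ h : MemLp g 2 μ, h.toLp g ∈ ℰ.domain

open Classical in
/-- The value `ℰ(g,k)` for functions `g, k` in `𝒟(ℰ)` (and `0` for other functions). -/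
def onFun (ℰ : SymmDirichletForm μ) (g k : Ω → ℝ) : ℝ :=
  if h : ℰ.MemDomain g ∧ ℰ.MemDomain k then
    ℰ.form ⟨h.1.choose.toLp g, h.1.choose_spec⟩ ⟨h.2.choose.toLp k, h.2.choose_spec⟩
  else 0

end SymmDirichletForm

/-- The super Poincaré inequality
`μ(f²) ≤ r ℰ(f,f) + β(r) μ(|f|)²` for all `r > 0` and `f ∈ 𝒟(ℰ)`, for a form `ℰ` with domain
`D ⊆ L²(μ)`. It is an inequality in `[0,∞]`, since `μ(|f|) = ∞` is possible if `μ` is infinite. -/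
def SuperPoincare {Ω : Type*} [MeasurableSpace Ω] (μ : Measure Ω) (D : Set (Lp ℝ 2 μ))
    (ℰ : D → D → ℝ) (β : ℝ → ℝ) : Prop :=
  ∀ r : ℝ, 0 < r → ∀ f : D,
    ∫⁻ x, ‖(f : Lp ℝ 2 μ) x‖ₑ ^ 2 ∂μ ≤
      ENNReal.ofReal (r * ℰ f f) +
        ENNReal.ofReal (β r) * (∫⁻ x, ‖(f : Lp ℝ 2 μ) x‖ₑ ∂μ) ^ 2

section Product

variable {ι : Type*} [Fintype ι] [DecidableEq ι] {E : ι → Type*} [∀ i, MeasurableSpace (E i)]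

/-- The section `f(x, ·) : E i → ℝ` of `f` at a point `x` of `∏_{j ≠ i} E j`. -/
def sliceAt (f : (∀ i, E i) → ℝ) (i : ι) (x : ∀ j : {j // j ≠ i}, E j) : E i → ℝ :=
  fun y => f ((Equiv.piSplitAt i E).symm (y, x))

/-- The measure `∏_{j ≠ i} μ j`. -/
def restMeasure (μ : ∀ i, Measure (E i)) (i : ι) : Measure (∀ j : {j // j ≠ i}, E j) :=
  Measure.pi fun j : {j // j ≠ i} => μ j

/-- The domain of the product form: those `f ∈ L²(∏ μ i)` such that, for every `i`, the section
`f(x, ·)` is in `𝒟(ℰ i)` for almost every `x`, and `x ↦ ℰ i (f(x, ·), f(x, ·))` has a finite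
integral. -/
def prodDomain {μ : ∀ i, Measure (E i)} (ℰ : ∀ i, SymmDirichletForm (μ i)) :
    Set (Lp ℝ 2 (Measure.pi μ)) :=
  {f | ∀ i, (∀ᵐ x ∂restMeasure μ i, (ℰ i).MemDomain (sliceAt f i x)) ∧
    Integrable (fun x => (ℰ i).onFun (sliceAt f i x) (sliceAt f i x)) (restMeasure μ i)}

/-- The product form `ℰ(f,g) = ∑ i, ∫ ℰ i (f(x, ·), g(x, ·)) (∏_{j ≠ i} μ j)(dx)`. -/
def prodForm {μ : ∀ i, Measure (E i)} (ℰ : ∀ i, SymmDirichletForm (μ i))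
    (f g : prodDomain ℰ) : ℝ :=
  ∑ i, ∫ x, (ℰ i).onFun (sliceAt (f : Lp ℝ 2 (Measure.pi μ)) i x)
    (sliceAt (g : Lp ℝ 2 (Measure.pi μ)) i x) ∂restMeasure μ i

end Product

end

/-!
By truncation, a super Poincaré inequality for `ℰ` bounds the mass that the density `f ^ 2` carries
on `{f ^ 2 > T μ(f ^ 2)}` by a multiple of `r ℰ(f, f) + β(r) / T μ(f ^ 2)`; conversely, by AM-GM,
such a tail bound gives back a super Poincaré inequality. Tail bounds tensorize. Normalize `f ^ 2`
to a probability density on the product space: if all the conditional densities of one variable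
given the others are at most `T i`, then off a set of probability at most `N / K`, by Markov's
inequality, the joint density is at most `∏ i, K * T i`. With `T i` of the order of `β i (r)`, this
produces the product of the rates `β i`.
-/

open scoped ENNReal NNReal

section Truncation

theorem le_two_mul_tsub_half {b t : ℝ≥0} (h : b ≤ t) : t ≤ 2 * (t - b / 2) := by
  rw [mul_tsub, mul_div_cancel₀ b two_ne_zero, two_mul]
  exact le_tsub_of_add_le_left (by gcongr)

theorem two_mul_mul_tsub_half_le_sq (b t : ℝ≥0) : 2 * b * (t - b / 2) ≤ t ^ 2 := by
  rcases le_total t (b / 2) with h | h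
  · simp [tsub_eq_zero_of_le h]
  · rw [← NNReal.coe_le_coe]
    push_cast [NNReal.coe_sub h]
    linarith [sq_nonneg ((t : ℝ) - b)]

theorem le_four_mul_add_of_le_add_sqrt_mul {F M : ℝ≥0} (hM : M ≠ 0) {A L : ℝ≥0∞}
    (h : (F : ℝ≥0∞) ≤ A + F / 2 + NNReal.sqrt (M * F) * L) :
    (F : ℝ≥0∞) ≤ 4 * A + 4 * M * L ^ 2 := by
  induction A with
  | top => simp
  | coe A =>
    induction L with
    | top => simp [hM]
    | coe L =>
      rw [← ENNReal.coe_two, ← ENNReal.coe_div two_ne_zero] at h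
      norm_cast at h ⊢
      rw [← NNReal.coe_le_coe] at h ⊢
      push_cast at h ⊢
      rw [Real.sqrt_mul M.coe_nonneg] at h
      -- AM-GM: `√(MF) L ≤ F / 4 + M L²`
      nlinarith [sq_nonneg (√(F : ℝ) / 2 - √(M : ℝ) * L), Real.sq_sqrt F.coe_nonneg,
        Real.sq_sqrt M.coe_nonneg]

variable {Ω : Type*} [MeasurableSpace Ω] {μ : Measure Ω}

theorem lintegral_sq_le_of_tail_le {g : Ω → ℝ≥0∞} (hg : Measurable g)
    (hg_top : ∫⁻ x, g x ^ 2 ∂μ ≠ ∞) {M : ℝ≥0} (hM : M ≠ 0) {A : ℝ≥0∞}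
    (h : ∫⁻ x in {x | M * ∫⁻ y, g y ^ 2 ∂μ < g x ^ 2}, g x ^ 2 ∂μ ≤
      A + (∫⁻ x, g x ^ 2 ∂μ) / 2) :
    ∫⁻ x, g x ^ 2 ∂μ ≤ 4 * A + 4 * M * (∫⁻ x, g x ∂μ) ^ 2 := by
  set S := {x | M * ∫⁻ y, g y ^ 2 ∂μ < g x ^ 2}
  have hS : MeasurableSet S := measurableSet_lt measurable_const (hg.pow_const 2)
  have hF := ENNReal.coe_toNNReal hg_top
  set F := (∫⁻ x, g x ^ 2 ∂μ).toNNReal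
  have bound_off_tail : ∀ x ∈ Sᶜ, g x ≤ NNReal.sqrt (M * F) := fun x hx => by
    simp only [S, Set.mem_compl_iff, Set.mem_ofPred_eq, not_lt] at hx
    refine (ENNReal.pow_le_pow_left_iff two_ne_zero).mp (hx.trans_eq ?_)
    rw [← hF, ← ENNReal.coe_pow, NNReal.sq_sqrt, ENNReal.coe_mul]
  have off_tail : ∫⁻ x in Sᶜ, g x ^ 2 ∂μ ≤ NNReal.sqrt (M * F) * ∫⁻ x, g x ∂μ :=
    calc ∫⁻ x in Sᶜ, g x ^ 2 ∂μ
        ≤ ∫⁻ x in Sᶜ, NNReal.sqrt (M * F) * g x ∂μ :=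
          setLIntegral_mono (hg.const_mul _) fun x hx => by
            rw [sq]; gcongr; exact bound_off_tail x hx
      _ ≤ ∫⁻ x, NNReal.sqrt (M * F) * g x ∂μ := setLIntegral_le_lintegral _ _
      _ = NNReal.sqrt (M * F) * ∫⁻ x, g x ∂μ := lintegral_const_mul _ hg
  have split := (lintegral_add_compl (fun x => g x ^ 2) hS).symm.trans_le
    (add_le_add h off_tail)
  rw [← hF] at split ⊢
  exact le_four_mul_add_of_le_add_sqrt_mul hM split

end Truncation

section PeakSet

variable {ι : Type*} [DecidableEq ι] {E : ι → Type*} [∀ i, MeasurableSpace (E i)]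
  (μ : ∀ i, Measure (E i))

/-- The points at which the density `ρ` exceeds `M` times its marginal over the variables in `s`.
Under the probability law proportional to `ρ`, it is the event that the conditional density of the
variables in `s` given all other ones exceeds `M`. -/
def peakSet (ρ : (∀ i, E i) → ℝ≥0∞) (s : Finset ι) (M : ℝ≥0) : Set (∀ i, E i) :=
  {x | M * (∫⋯∫⁻_s, ρ ∂μ) x < ρ x}

variable {ρ : (∀ i, E i) → ℝ≥0∞} {s t : Finset ι}

theorem peakSet_union_subset (hρ_top : ∀ x, ρ x ≠ ∞) {K : ℝ≥0} (hK : K ≠ 0) (M M' : ℝ≥0) :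
    peakSet μ ρ (s ∪ t) (K * M * M') ⊆ peakSet μ ρ s M ∪ peakSet μ ρ t M' ∪
      {x | K * ρ x < (∫⋯∫⁻_s, ρ ∂μ) x * ((∫⋯∫⁻_s ∪ t, ρ ∂μ) x)⁻¹ * (∫⋯∫⁻_t, ρ ∂μ) x} := by
  intro x hx
  contrapose! hx
  simp only [peakSet, Set.mem_union, Set.mem_ofPred_eq, not_or, not_lt] at hx ⊢
  obtain ⟨⟨hs, ht⟩, hst⟩ := hx
  rcases eq_or_ne (ρ x) 0 with h0 | h0
  · simp [h0]
  have hM : (M : ℝ≥0∞) ≠ 0 := fun h => h0 (by simpa [h] using hs)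
  have hM' : (M' : ℝ≥0∞) ≠ 0 := fun h => h0 (by simpa [h] using ht)
  rw [← ENNReal.div_le_iff_le_mul (.inr ENNReal.coe_ne_top)
    (.inr (by simp_all)), ← ENNReal.mul_le_mul_iff_left h0 (hρ_top x)]
  calc ρ x / (∫⋯∫⁻_s ∪ t, ρ ∂μ) x * ρ x
      = ρ x * ((∫⋯∫⁻_s ∪ t, ρ ∂μ) x)⁻¹ * ρ x := by rw [div_eq_mul_inv]
    _ ≤ M * (∫⋯∫⁻_s, ρ ∂μ) x * ((∫⋯∫⁻_s ∪ t, ρ ∂μ) x)⁻¹ * (M' * (∫⋯∫⁻_t, ρ ∂μ) x) := by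
        gcongr
    _ = M * M' *
          ((∫⋯∫⁻_s, ρ ∂μ) x * ((∫⋯∫⁻_s ∪ t, ρ ∂μ) x)⁻¹ * (∫⋯∫⁻_t, ρ ∂μ) x) := by ring
    _ ≤ M * M' * (K * ρ x) := by gcongr
    _ = ↑(K * M * M') * ρ x := by push_cast; ring

theorem lmarginal_mul_of_forall_eq {c f : (∀ i, E i) → ℝ≥0∞}
    (hc : ∀ x y : ∀ i, E i, (∀ i ∉ s, x i = y i) → c x = c y) (hf : Measurable f) :
    ∫⋯∫⁻_s, (fun x => c x * f x) ∂μ = fun x => c x * (∫⋯∫⁻_s, f ∂μ) x := by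
  ext x
  have c_update (y : ∀ i : s, E i) : c (Function.updateFinset x s y) = c x :=
    hc _ _ fun i hi => by simp [Function.updateFinset_def, hi]
  simp only [lmarginal, c_update]
  exact lintegral_const_mul _ (hf.comp measurable_updateFinset)

variable [∀ i, SigmaFinite (μ i)]

theorem measurableSet_peakSet (hρ : Measurable ρ) (M : ℝ≥0) :
    MeasurableSet (peakSet μ ρ s M) :=
  measurableSet_lt ((hρ.lmarginal μ).const_mul _) hρ

variable [Fintype ι]

/-- Integrating over the variables in `s` first turns the last factor into the marginal over
`s ∪ t`, which cancels. -/
theorem lintegral_lmarginal_mul_inv_mul_le (hρ : Measurable ρ) (hst : Disjoint s t) :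
    ∫⁻ x, (∫⋯∫⁻_s, ρ ∂μ) x * ((∫⋯∫⁻_s ∪ t, ρ ∂μ) x)⁻¹ * (∫⋯∫⁻_t, ρ ∂μ) x ∂Measure.pi μ ≤
      ∫⁻ x, ρ x ∂Measure.pi μ := by
  refine lintegral_le_of_lmarginal_le s
    (((hρ.lmarginal μ).mul (hρ.lmarginal μ).inv).mul (hρ.lmarginal μ)) hρ ?_
  rw [lmarginal_mul_of_forall_eq μ
    (c := fun x => (∫⋯∫⁻_s, ρ ∂μ) x * ((∫⋯∫⁻_s ∪ t, ρ ∂μ) x)⁻¹) _ (hρ.lmarginal μ)]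
  · intro x
    dsimp only
    rw [← lmarginal_union μ ρ hρ hst, mul_assoc]
    exact mul_le_of_le_one_right zero_le (ENNReal.inv_mul_le_one _)
  · intro x y hxy
    rw [lmarginal_congr μ ρ hxy, lmarginal_congr (s := s ∪ t) μ ρ fun j hj =>
      hxy j fun hjs => hj (Finset.mem_union_left t hjs)]

theorem setLIntegral_lmarginal_mul_inv_mul_gt_le (hρ : Measurable ρ) (hst : Disjoint s t)
    {K : ℝ≥0} (hK : K ≠ 0) :
    ∫⁻ x in {x | K * ρ x <
        (∫⋯∫⁻_s, ρ ∂μ) x * ((∫⋯∫⁻_s ∪ t, ρ ∂μ) x)⁻¹ * (∫⋯∫⁻_t, ρ ∂μ) x}, ρ x ∂Measure.pi μ ≤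
      (K : ℝ≥0∞)⁻¹ * ∫⁻ x, ρ x ∂Measure.pi μ := by
  have hK' : (K : ℝ≥0∞) ≠ 0 := ENNReal.coe_ne_zero.mpr hK
  set q := fun x => (∫⋯∫⁻_s, ρ ∂μ) x * ((∫⋯∫⁻_s ∪ t, ρ ∂μ) x)⁻¹ * (∫⋯∫⁻_t, ρ ∂μ) x
  have hq : Measurable q := ((hρ.lmarginal μ).mul (hρ.lmarginal μ).inv).mul (hρ.lmarginal μ)
  calc ∫⁻ x in {x | K * ρ x < q x}, ρ x ∂Measure.pi μ
      ≤ ∫⁻ x in {x | K * ρ x < q x}, (K : ℝ≥0∞)⁻¹ * q x ∂Measure.pi μ :=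
        setLIntegral_mono (hq.const_mul _) fun x hx =>
          (ENNReal.mul_le_iff_le_inv hK' ENNReal.coe_ne_top).mp (le_of_lt hx)
    _ ≤ ∫⁻ x, (K : ℝ≥0∞)⁻¹ * q x ∂Measure.pi μ := setLIntegral_le_lintegral _ _
    _ = (K : ℝ≥0∞)⁻¹ * ∫⁻ x, q x ∂Measure.pi μ := lintegral_const_mul _ hq
    _ ≤ (K : ℝ≥0∞)⁻¹ * ∫⁻ x, ρ x ∂Measure.pi μ :=
        mul_le_mul_right (lintegral_lmarginal_mul_inv_mul_le μ hρ hst) _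

theorem setLIntegral_peakSet_union_le (hρ : Measurable ρ) (hρ_top : ∀ x, ρ x ≠ ∞)
    (hst : Disjoint s t) {K : ℝ≥0} (hK : K ≠ 0) (M M' : ℝ≥0) :
    ∫⁻ x in peakSet μ ρ (s ∪ t) (K * M * M'), ρ x ∂Measure.pi μ ≤
      ∫⁻ x in peakSet μ ρ s M, ρ x ∂Measure.pi μ + ∫⁻ x in peakSet μ ρ t M', ρ x ∂Measure.pi μ +
        (K : ℝ≥0∞)⁻¹ * ∫⁻ x, ρ x ∂Measure.pi μ := by
  refine (lintegral_mono_set (peakSet_union_subset μ hρ_top hK M M')).trans ?_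
  refine (lintegral_union_le _ _ _).trans (add_le_add (lintegral_union_le _ _ _) ?_)
  exact setLIntegral_lmarginal_mul_inv_mul_gt_le μ hρ hst hK

theorem setLIntegral_peakSet_prod_le (hρ : Measurable ρ) (hρ_top : ∀ x, ρ x ≠ ∞)
    {K : ℝ≥0} (hK : K ≠ 0) (T : ι → ℝ≥0) (s : Finset ι) :
    ∫⁻ x in peakSet μ ρ s (∏ i ∈ s, K * T i), ρ x ∂Measure.pi μ ≤
      ∑ i ∈ s, (∫⁻ x in peakSet μ ρ {i} (T i), ρ x ∂Measure.pi μ +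
        (K : ℝ≥0∞)⁻¹ * ∫⁻ x, ρ x ∂Measure.pi μ) := by
  induction s using Finset.induction_on with
  | empty => simp [peakSet]
  | insert i s his ih =>
    rw [Finset.sum_insert his, Finset.prod_insert his, Finset.insert_eq]
    refine (setLIntegral_peakSet_union_le μ hρ hρ_top (Finset.disjoint_singleton_left.mpr his)
      hK _ _).trans ?_
    rw [add_right_comm]
    gcongr

end PeakSet

theorem lintegral_enorm_sq_ne_top {Ω : Type*} [MeasurableSpace Ω] {μ : Measure Ω}
    (f : Lp ℝ 2 μ) : ∫⁻ x, ‖f x‖ₑ ^ 2 ∂μ ≠ ∞ := by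
  simpa using (lintegral_rpow_enorm_lt_top_of_eLpNorm_lt_top (by norm_num) (by norm_num)
    (Lp.memLp f).2).ne

namespace SymmDirichletForm

variable {Ω : Type*} [MeasurableSpace Ω] {μ : Measure Ω} (ℰ : SymmDirichletForm μ)

theorem form_sub_self_le (f g : ℰ.domain) :
    ℰ.form (f - g) (f - g) ≤ 2 * (ℰ.form f f + ℰ.form g g) := by
  have parallelogram : ℰ.form (f - g) (f - g) + ℰ.form (f + g) (f + g) =
      2 * (ℰ.form f f + ℰ.form g g) := by
    simp only [map_add, map_sub, LinearMap.add_apply, LinearMap.sub_apply]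
    ring
  linarith [ℰ.nonneg (f + g)]

theorem exists_clip (f : ℰ.domain) {a : ℝ} (ha : 0 < a) :
    ∃ g : ℰ.domain, ((g : Lp ℝ 2 μ) =ᵐ[μ] fun x => min (max ((f : Lp ℝ 2 μ) x) 0) a) ∧
      ℰ.form g g ≤ ℰ.form f f := by
  obtain ⟨u, hu, hu_le⟩ := ℰ.markov (a⁻¹ • f)
  refine ⟨a • u, ?_, ?_⟩
  · filter_upwards [Lp.coeFn_smul a (u : Lp ℝ 2 μ), Lp.coeFn_smul a⁻¹ (f : Lp ℝ 2 μ), hu]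
      with x h_smul_u h_smul_f hux
    rw [Submodule.coe_smul, h_smul_u, Pi.smul_apply, hux, Submodule.coe_smul, h_smul_f,
      Pi.smul_apply, smul_eq_mul, smul_eq_mul, mul_min_of_nonneg _ _ ha.le,
      mul_max_of_nonneg _ _ ha.le, mul_inv_cancel_left₀ ha.ne', mul_zero, mul_one]
  · calc ℰ.form (a • u) (a • u) = a * (a * ℰ.form u u) := by
          simp only [map_smul, LinearMap.smul_apply, smul_eq_mul]
      _ ≤ a * (a * ℰ.form (a⁻¹ • f) (a⁻¹ • f)) := by gcongr
      _ = ℰ.form (a • a⁻¹ • f) (a • a⁻¹ • f) := by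
          simp only [map_smul ℰ.form a, map_smul (ℰ.form _) a, LinearMap.smul_apply, smul_eq_mul]
      _ = ℰ.form f f := by rw [smul_inv_smul₀ ha.ne' f]

/-- The parallelogram identity costs a factor `10`, but it spares the proof that every normal
contraction operates on `ℰ`. -/
theorem exists_softThreshold (f : ℰ.domain) {a : ℝ≥0} (ha : 0 < a) :
    ∃ g : ℰ.domain, (∀ᵐ x ∂μ, ‖(g : Lp ℝ 2 μ) x‖₊ = ‖(f : Lp ℝ 2 μ) x‖₊ - a) ∧
      ℰ.form g g ≤ 10 * ℰ.form f f := by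
  obtain ⟨u, hu, hu_le⟩ := ℰ.exists_clip f (NNReal.coe_pos.mpr ha)
  obtain ⟨v, hv, hv_le⟩ := ℰ.exists_clip (-f) (NNReal.coe_pos.mpr ha)
  simp only [map_neg, LinearMap.neg_apply, neg_neg] at hv_le
  refine ⟨f - (u - v), ?_, ?_⟩
  · filter_upwards [hu, hv, Lp.coeFn_neg (f : Lp ℝ 2 μ),
      Lp.coeFn_sub (f : Lp ℝ 2 μ) ((u : Lp ℝ 2 μ) - v), Lp.coeFn_sub (u : Lp ℝ 2 μ) v]
      with x hux hvx h_neg h_sub h_sub_uv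
    rw [Submodule.coe_sub, Submodule.coe_sub, h_sub, Pi.sub_apply, h_sub_uv, Pi.sub_apply, hux,
      hvx, Submodule.coe_neg, h_neg, Pi.neg_apply, ← NNReal.coe_inj, NNReal.coe_sub_def,
      coe_nnnorm, coe_nnnorm, Real.norm_eq_abs, Real.norm_eq_abs]
    have := a.coe_nonneg
    grind
  · linarith [ℰ.form_sub_self_le f (u - v), ℰ.form_sub_self_le u v]

theorem exists_truncation (f : ℰ.domain) {b : ℝ≥0} (hb : b ≠ 0) :
    ∃ g : ℰ.domain, ℰ.form g g ≤ 10 * ℰ.form f f ∧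
      ∫⁻ x in {x | b < ‖(f : Lp ℝ 2 μ) x‖ₑ}, ‖(f : Lp ℝ 2 μ) x‖ₑ ^ 2 ∂μ ≤
        4 * ∫⁻ x, ‖(g : Lp ℝ 2 μ) x‖ₑ ^ 2 ∂μ ∧
      2 * ∫⁻ x, ‖(g : Lp ℝ 2 μ) x‖ₑ ∂μ ≤ (∫⁻ x, ‖(f : Lp ℝ 2 μ) x‖ₑ ^ 2 ∂μ) / b := by
  obtain ⟨g, hg, hg_le⟩ := ℰ.exists_softThreshold f (half_pos (pos_of_ne_zero hb))
  refine ⟨g, hg_le, ?_, ?_⟩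
  · have f_gt : MeasurableSet {x | b < ‖(f : Lp ℝ 2 μ) x‖ₑ} :=
      measurableSet_lt measurable_const (Lp.stronglyMeasurable _).enorm
    rw [← lintegral_const_mul' _ _ (by simp)]
    refine (setLIntegral_mono_ae' f_gt ?_).trans (setLIntegral_le_lintegral _ _)
    filter_upwards [hg] with x hx hbx
    rw [show (4 : ℝ≥0∞) = 2 ^ 2 by norm_num, ← mul_pow]
    simp only [enorm_eq_nnnorm, hx] at hbx ⊢
    gcongr
    exact_mod_cast le_two_mul_tsub_half (ENNReal.coe_lt_coe.mp hbx).le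
  · rw [← lintegral_const_mul' _ _ (by simp),
      ENNReal.le_div_iff_mul_le (.inl (by simpa using hb)) (.inl ENNReal.coe_ne_top),
      ← lintegral_mul_const' _ _ ENNReal.coe_ne_top]
    refine lintegral_mono_ae ?_
    filter_upwards [hg] with x hx
    simp only [enorm_eq_nnnorm, hx]
    rw [mul_right_comm]
    exact_mod_cast two_mul_mul_tsub_half_le_sq b ‖(f : Lp ℝ 2 μ) x‖₊

theorem setLIntegral_enorm_gt_le {β : ℝ → ℝ}
    (hSP : SuperPoincare μ ℰ.domain (fun f g => ℰ.form f g) β) {s : ℝ} (hs : 0 < s)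
    (f : ℰ.domain) {b : ℝ≥0} (hb : b ≠ 0) :
    ∫⁻ x in {x | b < ‖(f : Lp ℝ 2 μ) x‖ₑ}, ‖(f : Lp ℝ 2 μ) x‖ₑ ^ 2 ∂μ ≤
      ENNReal.ofReal (40 * s * ℰ.form f f) +
        ENNReal.ofReal (β s) * ((∫⁻ x, ‖(f : Lp ℝ 2 μ) x‖ₑ ^ 2 ∂μ) / b) ^ 2 := by
  obtain ⟨g, hg_le, f_le_g, g_le_f⟩ := ℰ.exists_truncation f hb
  calc ∫⁻ x in {x | b < ‖(f : Lp ℝ 2 μ) x‖ₑ}, ‖(f : Lp ℝ 2 μ) x‖ₑ ^ 2 ∂μ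
      ≤ 4 * ∫⁻ x, ‖(g : Lp ℝ 2 μ) x‖ₑ ^ 2 ∂μ := f_le_g
    _ ≤ 4 * (ENNReal.ofReal (s * ℰ.form g g) +
          ENNReal.ofReal (β s) * (∫⁻ x, ‖(g : Lp ℝ 2 μ) x‖ₑ ∂μ) ^ 2) := by
        gcongr
        exact hSP s hs g
    _ = ENNReal.ofReal (4 * (s * ℰ.form g g)) +
          ENNReal.ofReal (β s) * (2 * ∫⁻ x, ‖(g : Lp ℝ 2 μ) x‖ₑ ∂μ) ^ 2 := by
        rw [ENNReal.ofReal_mul (by simp : (0 : ℝ) ≤ 4), ENNReal.ofReal_ofNat]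
        ring
    _ ≤ ENNReal.ofReal (40 * s * ℰ.form f f) +
          ENNReal.ofReal (β s) * ((∫⁻ x, ‖(f : Lp ℝ 2 μ) x‖ₑ ^ 2 ∂μ) / b) ^ 2 := by
        have energy_le : 4 * (s * ℰ.form g g) ≤ 40 * s * ℰ.form f f := by
          linarith [mul_le_mul_of_nonneg_left hg_le hs.le]
        gcongr

theorem setLIntegral_tail_le {β : ℝ → ℝ}
    (hSP : SuperPoincare μ ℰ.domain (fun f g => ℰ.form f g) β) {s : ℝ} (hs : 0 < s) {T : ℝ≥0}
    (hT : T ≠ 0) (f : ℰ.domain) :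
    ∫⁻ x in {x | T * ∫⁻ y, ‖(f : Lp ℝ 2 μ) y‖ₑ ^ 2 ∂μ < ‖(f : Lp ℝ 2 μ) x‖ₑ ^ 2},
        ‖(f : Lp ℝ 2 μ) x‖ₑ ^ 2 ∂μ ≤
      ENNReal.ofReal (40 * s * ℰ.form f f) +
        ENNReal.ofReal (β s) / T * ∫⁻ y, ‖(f : Lp ℝ 2 μ) y‖ₑ ^ 2 ∂μ := by
  have hF := ENNReal.coe_toNNReal (lintegral_enorm_sq_ne_top (f : Lp ℝ 2 μ))
  set F := (∫⁻ y, ‖(f : Lp ℝ 2 μ) y‖ₑ ^ 2 ∂μ).toNNReal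
  rcases eq_or_ne F 0 with hF0 | hF0
  · refine (setLIntegral_le_lintegral _ _).trans ?_
    simp [← hF, hF0]
  have hb : NNReal.sqrt (T * F) ≠ 0 := by simp [hT, hF0]
  have lt_sq_iff (x : Ω) : T * F < ‖(f : Lp ℝ 2 μ) x‖ₑ ^ 2 ↔
      NNReal.sqrt (T * F) < ‖(f : Lp ℝ 2 μ) x‖ₑ := by
    rw [← ENNReal.coe_mul, ← ENNReal.pow_lt_pow_left_iff two_ne_zero (a := NNReal.sqrt (T * F)),
      ← ENNReal.coe_pow, NNReal.sq_sqrt]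
  have div_sqrt_sq : ((F : ℝ≥0∞) / NNReal.sqrt (T * F)) ^ 2 = F / T := by
    rw [← ENNReal.coe_div hb, ← ENNReal.coe_div hT, ← ENNReal.coe_pow, div_pow, NNReal.sq_sqrt,
      sq, mul_div_mul_right _ _ hF0]
  have tail := ℰ.setLIntegral_enorm_gt_le hSP hs f hb
  simp only [← hF, lt_sq_iff] at tail ⊢
  rwa [div_sqrt_sq, ← mul_div_assoc, ENNReal.mul_div_right_comm] at tail

theorem onFun_self (g : Ω → ℝ) (h : MemLp g 2 μ) (hg : h.toLp g ∈ ℰ.domain) :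
    ℰ.onFun g g = ℰ.form ⟨h.toLp g, hg⟩ ⟨h.toLp g, hg⟩ := by
  have hg' : ℰ.MemDomain g := ⟨h, hg⟩
  rw [onFun, dif_pos ⟨hg', hg'⟩]

theorem onFun_self_nonneg (g : Ω → ℝ) : 0 ≤ ℰ.onFun g g := by
  by_cases hg : ℰ.MemDomain g
  · rw [ℰ.onFun_self g hg.choose hg.choose_spec]
    exact ℰ.nonneg _
  · simp [onFun, hg]

theorem MemDomain.setLIntegral_tail_le {ℰ : SymmDirichletForm μ} {g : Ω → ℝ}
    (hg : ℰ.MemDomain g) {β : ℝ → ℝ}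
    (hSP : SuperPoincare μ ℰ.domain (fun f g => ℰ.form f g) β) {s : ℝ} (hs : 0 < s) {T : ℝ≥0}
    (hT : T ≠ 0) :
    ∫⁻ x in {x | T * ∫⁻ y, ‖g y‖ₑ ^ 2 ∂μ < ‖g x‖ₑ ^ 2}, ‖g x‖ₑ ^ 2 ∂μ ≤
      ENNReal.ofReal (40 * s * ℰ.onFun g g) +
        ENNReal.ofReal (β s) / T * ∫⁻ y, ‖g y‖ₑ ^ 2 ∂μ := by
  obtain ⟨hg2, hg_mem⟩ := hg
  have toLp_sq : (fun x => ‖hg2.toLp g x‖ₑ ^ 2) =ᵐ[μ] fun x => ‖g x‖ₑ ^ 2 :=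
    hg2.coeFn_toLp.mono fun x hx => by simp only [hx]
  have key := ℰ.setLIntegral_tail_le hSP hs hT ⟨hg2.toLp g, hg_mem⟩
  rw [← ℰ.onFun_self g hg2 hg_mem] at key
  simp only [lintegral_congr_ae toLp_sq] at key
  rw [lintegral_congr_ae (ae_restrict_of_ae toLp_sq)] at key
  refine (setLIntegral_congr ?_).trans_le key
  refine eventuallyEq_set.mpr (toLp_sq.mono fun x hx => ?_)
  simp only [Set.mem_ofPred_eq, hx]

end SymmDirichletForm

section Slice

variable {ι : Type*} [DecidableEq ι] {E : ι → Type*}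

theorem update_piSplitAt_symm (i : ι) (y w : E i) (x : ∀ j : {j // j ≠ i}, E j) :
    Function.update ((Equiv.piSplitAt i E).symm (y, x)) i w =
      (Equiv.piSplitAt i E).symm (w, x) := by
  ext j
  rcases eq_or_ne j i with rfl | h
  · simp [Equiv.piSplitAt]
  · simp [Equiv.piSplitAt, h]

variable [∀ i, MeasurableSpace (E i)]

theorem preimage_piSplitAt_symm_peakSet (μ : ∀ i, Measure (E i)) (ρ : (∀ i, E i) → ℝ≥0∞) (i : ι)
    (M : ℝ≥0) (x : ∀ j : {j // j ≠ i}, E j) :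
    (fun y => (Equiv.piSplitAt i E).symm (y, x)) ⁻¹' peakSet μ ρ {i} M =
      {y | M * ∫⁻ w, ρ ((Equiv.piSplitAt i E).symm (w, x)) ∂μ i <
        ρ ((Equiv.piSplitAt i E).symm (y, x))} := by
  ext y
  simp only [peakSet, lmarginal_singleton, Set.mem_preimage, Set.mem_ofPred_eq,
    update_piSplitAt_symm]

theorem measurable_piSplitAt_symm (i : ι) : Measurable (Equiv.piSplitAt i E).symm := by
  refine measurable_pi_iff.mpr fun j => ?_
  rcases eq_or_ne j i with rfl | h
  · simpa [Equiv.piSplitAt] using measurable_fst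
  · simp only [Equiv.piSplitAt, Equiv.coe_fn_symm_mk, h, dite_false]
    exact (measurable_pi_apply (⟨j, h⟩ : {j // j ≠ i})).comp measurable_snd

variable [Fintype ι] (μ : ∀ i, Measure (E i)) [∀ i, SigmaFinite (μ i)]

instance sigmaFinite_restMeasure (i : ι) : SigmaFinite (restMeasure μ i) := by
  unfold restMeasure
  infer_instance

theorem measurePreserving_piSplitAt_symm (i : ι) :
    MeasurePreserving (Equiv.piSplitAt i E).symm ((μ i).prod (restMeasure μ i))
      (Measure.pi μ) := by
  refine ⟨measurable_piSplitAt_symm i, (Measure.pi_eq fun s hs => ?_).symm⟩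
  have preimage_box : (Equiv.piSplitAt i E).symm ⁻¹' Set.univ.pi s =
      s i ×ˢ Set.univ.pi fun j : {j // j ≠ i} => s j := by
    ext ⟨y, x⟩
    simp only [Set.mem_preimage, Set.mem_univ_pi, Set.mem_prod]
    constructor
    · intro h
      exact ⟨by simpa [Equiv.piSplitAt] using h i,
        fun j => by simpa [Equiv.piSplitAt, j.2] using h j⟩
    · rintro ⟨hy, hx⟩ j
      rcases eq_or_ne j i with rfl | h
      · simpa [Equiv.piSplitAt] using hy
      · simpa [Equiv.piSplitAt, h] using hx ⟨j, h⟩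
  rw [Measure.map_apply (measurable_piSplitAt_symm i) (MeasurableSet.univ_pi hs), preimage_box,
    Measure.prod_prod, restMeasure, Measure.pi_pi]
  exact (Fintype.prod_eq_mul_prod_subtype_ne (fun j => μ j (s j)) i).symm

theorem setLIntegral_pi_eq_lintegral_slice (i : ι) {ρ : (∀ i, E i) → ℝ≥0∞} (hρ : Measurable ρ)
    {A : Set (∀ i, E i)} (hA : MeasurableSet A) :
    ∫⁻ z in A, ρ z ∂Measure.pi μ =
      ∫⁻ x, ∫⁻ y in (fun y => (Equiv.piSplitAt i E).symm (y, x)) ⁻¹' A,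
        ρ ((Equiv.piSplitAt i E).symm (y, x)) ∂μ i ∂restMeasure μ i := by
  have measurable_section (x : ∀ j : {j // j ≠ i}, E j) :
      Measurable fun y => (Equiv.piSplitAt i E).symm (y, x) :=
    (measurable_piSplitAt_symm i).comp measurable_prodMk_right
  simp only [← lintegral_indicator hA, ← lintegral_indicator (measurable_section _ hA)]
  rw [← (measurePreserving_piSplitAt_symm μ i).lintegral_comp (hρ.indicator hA)]
  exact lintegral_prod_symm _
    ((hρ.indicator hA).comp (measurable_piSplitAt_symm i)).aemeasurable

theorem lintegral_pi_eq_lintegral_slice (i : ι) {ρ : (∀ i, E i) → ℝ≥0∞} (hρ : Measurable ρ) :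
    ∫⁻ z, ρ z ∂Measure.pi μ =
      ∫⁻ x, ∫⁻ y, ρ ((Equiv.piSplitAt i E).symm (y, x)) ∂μ i ∂restMeasure μ i := by
  simpa using setLIntegral_pi_eq_lintegral_slice μ i hρ .univ

end Slice

section ProductForm

variable {ι : Type*} [Fintype ι] [DecidableEq ι] {E : ι → Type*} [∀ i, MeasurableSpace (E i)]
  {μ : ∀ i, Measure (E i)} (ℰ : ∀ i, SymmDirichletForm (μ i))

/-- The contribution `∫ ℰ i (f(x, ·), f(x, ·)) (∏_{j ≠ i} μ j)(dx)` of the `i`-th factor to the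
energy of `f` under the product form. -/
noncomputable def sectionEnergy (f : (∀ i, E i) → ℝ) (i : ι) : ℝ :=
  ∫ x, (ℰ i).onFun (sliceAt f i x) (sliceAt f i x) ∂restMeasure μ i

theorem sectionEnergy_nonneg (f : (∀ i, E i) → ℝ) (i : ι) : 0 ≤ sectionEnergy ℰ f i :=
  integral_nonneg fun _ => (ℰ i).onFun_self_nonneg _

variable [∀ i, SigmaFinite (μ i)] {ℰ}

theorem setLIntegral_peakSet_singleton_le {i : ι} {β : ℝ → ℝ}
    (hSP : SuperPoincare (μ i) (ℰ i).domain (fun f g => (ℰ i).form f g) β) {s : ℝ} (hs : 0 < s)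
    {T : ℝ≥0} (hT : T ≠ 0) {f : Lp ℝ 2 (Measure.pi μ)} (hf : f ∈ prodDomain ℰ) :
    ∫⁻ z in peakSet μ (fun z => ‖f z‖ₑ ^ 2) {i} T, ‖f z‖ₑ ^ 2 ∂Measure.pi μ ≤
      ENNReal.ofReal (40 * s * sectionEnergy ℰ f i) +
        ENNReal.ofReal (β s) / T * ∫⁻ z, ‖f z‖ₑ ^ 2 ∂Measure.pi μ := by
  obtain ⟨mem_domain, integrable_energy⟩ := hf i
  have hρ : Measurable fun z => ‖f z‖ₑ ^ 2 := (Lp.stronglyMeasurable f).enorm.pow_const 2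
  have integrated_mass : Measurable fun x => ∫⁻ y, ‖sliceAt f i x y‖ₑ ^ 2 ∂μ i :=
    (hρ.comp (measurable_piSplitAt_symm i)).lintegral_prod_left'
  calc ∫⁻ z in peakSet μ (fun z => ‖f z‖ₑ ^ 2) {i} T, ‖f z‖ₑ ^ 2 ∂Measure.pi μ
      = ∫⁻ x, ∫⁻ y in {y | T * ∫⁻ w, ‖sliceAt f i x w‖ₑ ^ 2 ∂μ i < ‖sliceAt f i x y‖ₑ ^ 2},
          ‖sliceAt f i x y‖ₑ ^ 2 ∂μ i ∂restMeasure μ i := by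
        rw [setLIntegral_pi_eq_lintegral_slice μ i hρ (measurableSet_peakSet μ hρ T)]
        simp only [preimage_piSplitAt_symm_peakSet, sliceAt]
    _ ≤ ∫⁻ x, (ENNReal.ofReal (40 * s * (ℰ i).onFun (sliceAt f i x) (sliceAt f i x)) +
          ENNReal.ofReal (β s) / T * ∫⁻ y, ‖sliceAt f i x y‖ₑ ^ 2 ∂μ i) ∂restMeasure μ i :=
        lintegral_mono_ae (mem_domain.mono fun x hx => hx.setLIntegral_tail_le hSP hs hT)
    _ = ENNReal.ofReal (40 * s * sectionEnergy ℰ f i) +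
          ENNReal.ofReal (β s) / T * ∫⁻ z, ‖f z‖ₑ ^ 2 ∂Measure.pi μ := by
        rw [lintegral_add_right _ (integrated_mass.const_mul _),
          lintegral_const_mul _ integrated_mass,
          ← ofReal_integral_eq_lintegral_ofReal (integrable_energy.const_mul _)
            (ae_of_all _ fun x => mul_nonneg (by positivity) ((ℰ i).onFun_self_nonneg _)),
          integral_const_mul, lintegral_pi_eq_lintegral_slice μ i hρ]
        rfl

theorem setLIntegral_pi_tail_le {β : ι → ℝ → ℝ} {s : ℝ} (hs : 0 < s) (hβ : ∀ i, 0 < β i s)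
    (hSP : ∀ i, SuperPoincare (μ i) (ℰ i).domain (fun f g => (ℰ i).form f g) (β i))
    {K : ℝ≥0} (hK : K ≠ 0) (f : prodDomain ℰ) :
    ∫⁻ z in {z | (∏ i, K ^ 2 * (β i s).toNNReal : ℝ≥0) *
          ∫⁻ w, ‖(f : Lp ℝ 2 (Measure.pi μ)) w‖ₑ ^ 2 ∂Measure.pi μ <
            ‖(f : Lp ℝ 2 (Measure.pi μ)) z‖ₑ ^ 2},
        ‖(f : Lp ℝ 2 (Measure.pi μ)) z‖ₑ ^ 2 ∂Measure.pi μ ≤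
      ENNReal.ofReal (40 * s * prodForm ℰ f f) + Fintype.card ι * (2 * (K : ℝ≥0∞)⁻¹) *
        ∫⁻ z, ‖(f : Lp ℝ 2 (Measure.pi μ)) z‖ₑ ^ 2 ∂Measure.pi μ := by
  obtain ⟨f, hf⟩ := f
  set ρ := fun z => ‖f z‖ₑ ^ 2
  set F := ∫⁻ z, ρ z ∂Measure.pi μ
  have hρ : Measurable ρ := (Lp.stronglyMeasurable f).enorm.pow_const 2
  have single (i : ι) : ∫⁻ z in peakSet μ ρ {i} (K * (β i s).toNNReal), ρ z ∂Measure.pi μ ≤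
      ENNReal.ofReal (40 * s * sectionEnergy ℰ f i) + (K : ℝ≥0∞)⁻¹ * F := by
    have hb : (β i s).toNNReal ≠ 0 := (Real.toNNReal_pos.mpr (hβ i)).ne'
    have ratio : ENNReal.ofReal (β i s) / (K * (β i s).toNNReal : ℝ≥0) = (K : ℝ≥0∞)⁻¹ := by
      rw [ENNReal.ofReal, ← ENNReal.coe_div (mul_ne_zero hK hb), div_mul_cancel_right₀ hb,
        ENNReal.coe_inv hK]
    rw [← ratio]
    exact setLIntegral_peakSet_singleton_le (hSP i) hs (mul_ne_zero hK hb) hf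
  have tail_eq : {z | (∏ i, K ^ 2 * (β i s).toNNReal : ℝ≥0) * F < ρ z} =
      peakSet μ ρ Finset.univ (∏ i, K * (K * (β i s).toNNReal)) := by
    simp only [peakSet, lmarginal_univ, sq, mul_assoc, F]
  calc ∫⁻ z in {z | (∏ i, K ^ 2 * (β i s).toNNReal : ℝ≥0) * F < ρ z}, ρ z ∂Measure.pi μ
      ≤ ∑ i, (∫⁻ z in peakSet μ ρ {i} (K * (β i s).toNNReal), ρ z ∂Measure.pi μ +
          (K : ℝ≥0∞)⁻¹ * F) := by
        rw [tail_eq]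
        exact setLIntegral_peakSet_prod_le μ hρ (fun z => by simp [ρ]) hK _ _
    _ ≤ ∑ i, (ENNReal.ofReal (40 * s * sectionEnergy ℰ f i) + (K : ℝ≥0∞)⁻¹ * F +
          (K : ℝ≥0∞)⁻¹ * F) := Finset.sum_le_sum fun i _ => add_le_add_left (single i) _
    _ = ENNReal.ofReal (40 * s * ∑ i, sectionEnergy ℰ f i) +
          Fintype.card ι * (2 * (K : ℝ≥0∞)⁻¹) * F := by
        rw [Finset.mul_sum, ENNReal.ofReal_sum_of_nonneg fun i _ =>
          mul_nonneg (by positivity) (sectionEnergy_nonneg ℰ f i)]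
        simp only [add_assoc, Finset.sum_add_distrib, Finset.sum_const, Finset.card_univ,
          nsmul_eq_mul]
        ring

theorem superPoincare_pi {β : ι → ℝ → ℝ} (hβ : ∀ i r, 0 < r → 0 < β i r)
    (hSP : ∀ i, SuperPoincare (μ i) (ℰ i).domain (fun f g => (ℰ i).form f g) (β i)) :
    SuperPoincare (Measure.pi μ) (prodDomain ℰ) (prodForm ℰ)
      (fun r => 4 * ∏ i, (4 * (Fintype.card ι + 1)) ^ 2 * β i (r / 160)) := by
  intro r hr f
  have hs : 0 < r / 160 := by positivity
  have hβs (i : ι) : 0 < β i (r / 160) := hβ i _ hs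
  set K : ℝ≥0 := 4 * (Fintype.card ι + 1)
  set M : ℝ≥0 := ∏ i, K ^ 2 * (β i (r / 160)).toNNReal
  have hK : K ≠ 0 := by positivity
  have hM : M ≠ 0 := Finset.prod_ne_zero_iff.mpr fun i _ =>
    mul_ne_zero (pow_ne_zero 2 hK) (Real.toNNReal_pos.mpr (hβs i)).ne'
  have coe_M : (M : ℝ) = ∏ i, (4 * (Fintype.card ι + 1) : ℝ) ^ 2 * β i (r / 160) := by
    simp [M, K, (hβs _).le]
  have card_mul_le_half : (Fintype.card ι : ℝ≥0∞) * (2 * (K : ℝ≥0∞)⁻¹) ≤ 2⁻¹ := by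
    rw [← ENNReal.coe_inv hK, ← ENNReal.coe_two, ← ENNReal.coe_inv two_ne_zero]
    norm_cast
    rw [← NNReal.coe_le_coe]
    push_cast [K]
    field_simp
    linarith
  have tail := setLIntegral_pi_tail_le hs hβs hSP hK f
  have bound := lintegral_sq_le_of_tail_le (Lp.stronglyMeasurable _).enorm
    (lintegral_enorm_sq_ne_top _) hM (tail.trans (add_le_add_right
      ((mul_le_mul_left card_mul_le_half _).trans_eq ENNReal.div_eq_inv_mul.symm) _))
  convert bound using 2
  · rw [← ENNReal.ofReal_ofNat, ← ENNReal.ofReal_mul (by norm_num)]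
    congr 1
    ring
  · beta_reduce
    rw [← coe_M, ENNReal.ofReal_mul (by norm_num), ENNReal.ofReal_ofNat,
      ENNReal.ofReal_coe_nnreal]

end ProductForm

section PowerRate

theorem SuperPoincare.mono {Ω : Type*} [MeasurableSpace Ω] {μ : Measure Ω} {D : Set (Lp ℝ 2 μ)}
    {ℰ : D → D → ℝ} {β γ : ℝ → ℝ} (h : SuperPoincare μ D ℰ β) (hβ : ∀ r, 0 < r → β r ≤ γ r) :
    SuperPoincare μ D ℰ γ := fun r hr f =>
  (h r hr f).trans (by gcongr; exact hβ r hr)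

theorem one_add_div_rpow_neg_le {a r q : ℝ} (ha : 1 ≤ a) (hr : 0 < r) (hq : 0 ≤ q) :
    1 + (r / a) ^ (-q) ≤ a ^ q * (1 + r ^ (-q)) := by
  have ha0 : 0 ≤ a := zero_le_one.trans ha
  rw [Real.div_rpow hr.le ha0, Real.rpow_neg ha0, div_inv_eq_mul, mul_comm (r ^ _), mul_one_add]
  gcongr
  exact Real.one_le_rpow ha hq

theorem prod_one_add_rpow_neg_le {ι : Type*} (s : Finset ι) {p : ι → ℝ} (hp : ∀ i ∈ s, 0 ≤ p i)
    {r : ℝ} (hr : 0 < r) :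
    ∏ i ∈ s, (1 + r ^ (-p i)) ≤ 2 ^ s.card * (1 + r ^ (-∑ i ∈ s, p i)) := by
  rcases le_total r 1 with h | h
  · calc ∏ i ∈ s, (1 + r ^ (-p i)) ≤ ∏ i ∈ s, (2 * r ^ (-p i)) := by
          refine Finset.prod_le_prod (fun i _ => by positivity) fun i hi => ?_
          linarith [Real.one_le_rpow_of_pos_of_le_one_of_nonpos hr h (neg_nonpos.mpr (hp i hi))]
      _ = 2 ^ s.card * r ^ (-∑ i ∈ s, p i) := by
          rw [Finset.prod_mul_distrib, Finset.prod_const, ← Finset.sum_neg_distrib,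
            Real.rpow_sum_of_pos hr]
      _ ≤ 2 ^ s.card * (1 + r ^ (-∑ i ∈ s, p i)) := by gcongr; linarith
  · calc ∏ i ∈ s, (1 + r ^ (-p i)) ≤ ∏ _i ∈ s, (2 : ℝ) := by
          refine Finset.prod_le_prod (fun i _ => by positivity) fun i hi => ?_
          linarith [Real.rpow_le_one_of_one_le_of_nonpos h (neg_nonpos.mpr (hp i hi))]
      _ = 2 ^ s.card * 1 := by simp
      _ ≤ 2 ^ s.card * (1 + r ^ (-∑ i ∈ s, p i)) := by
          gcongr
          linarith [Real.rpow_nonneg hr.le (-∑ i ∈ s, p i)]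

end PowerRate

theorem proposition2p2_general {ι : Type*} [Fintype ι] [DecidableEq ι] {E : ι → Type*}
    [∀ i, MeasurableSpace (E i)] (μ : ∀ i, Measure (E i)) [∀ i, SigmaFinite (μ i)]
    (ℰ : ∀ i, SymmDirichletForm (μ i)) (p : ι → ℝ) (hp : ∀ i, 0 ≤ p i)
    (hSP : ∀ i, ∃ c : ℝ, 0 < c ∧
      SuperPoincare (μ i) (ℰ i).domain (fun f g => (ℰ i).form f g)
        (fun r => c * (1 + r ^ (-p i)))) :
    ∃ c : ℝ, 0 < c ∧
      SuperPoincare (Measure.pi μ) (prodDomain ℰ) (prodForm ℰ)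
        (fun r => c * (1 + r ^ (-∑ i, p i))) := by
  choose c hc hSP using hSP
  set n := Fintype.card ι
  set C : ℝ := ∏ i, (4 * (n + 1)) ^ 2 * c i
  have hC : 0 < C := Finset.prod_pos fun i _ => mul_pos (by positivity) (hc i)
  refine ⟨4 * C * (2 ^ n * 160 ^ ∑ i, p i), by positivity, ?_⟩
  refine (superPoincare_pi (fun i r hr => mul_pos (hc i) (by positivity)) hSP).mono fun r hr => ?_
  calc 4 * ∏ i, (4 * (n + 1) : ℝ) ^ 2 * (c i * (1 + (r / 160) ^ (-p i)))
      = 4 * C * ∏ i, (1 + (r / 160) ^ (-p i)) := by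
        simp only [← mul_assoc, Finset.prod_mul_distrib, C]
    _ ≤ 4 * C * (2 ^ n * (1 + (r / 160) ^ (-∑ i, p i))) := by
        gcongr
        exact prod_one_add_rpow_neg_le _ (fun i _ => hp i) (by positivity)
    _ ≤ 4 * C * (2 ^ n * (160 ^ (∑ i, p i) * (1 + r ^ (-∑ i, p i)))) := by
        gcongr
        exact one_add_div_rpow_neg_le (by norm_num) hr (Finset.sum_nonneg fun i _ => hp i)
    _ = 4 * C * (2 ^ n * 160 ^ ∑ i, p i) * (1 + r ^ (-∑ i, p i)) := by ring

theorem proposition2p2 {N : ℕ} {E : Fin N → Type*} [∀ i, MeasurableSpace (E i)]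
    (μ : ∀ i, Measure (E i)) [∀ i, SigmaFinite (μ i)]
    (ℰ : ∀ i, SymmDirichletForm (μ i))
    (p : Fin N → ℝ) (hp : ∀ i, 0 < p i)
    (hSP : ∀ i, ∃ c : ℝ, 0 < c ∧
      SuperPoincare (μ i) (ℰ i).domain (fun f g => (ℰ i).form f g)
        (fun r => c * (1 + r ^ (-p i)))) :
    ∃ c : ℝ, 0 < c ∧
      SuperPoincare (Measure.pi μ) (prodDomain ℰ) (prodForm ℰ)
        (fun r => c * (1 + r ^ (-∑ i, p i))) :=
  proposition2p2_general μ ℰ p (fun i => (hp i).le) hSP
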